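/- Let $n\ge 1$, $\sigma_W>0$, let $W\sim\mathcal N(0,\sigma_W^2 I_n)$ be a random row vector in $\mathbb R^{1\times n}$, and let $\Sigma_X\in\mathbb R^{n\times n}$ be symmetric positive semidefinite with eigenvalues $\lambda_1,\dots,\lambda_n$ (with multiplicity). A weight-only quantization scheme consists of a (measurable) encoder $f:\mathbb R^n\times\mathbb R^{n\times n}\to\{0,1\}^*$ and a decoder $g:\{0,1\}^*\to\mathbb R^n$, where the set of codewords $\{f(w,\Sigma_X):w\in\mathbb R^n\}$ is uniquely decodable or consists of the empty string only. With $\hat W=g(f(W,\Sigma_X))$, its distortion is $\frac1n\mathbb E\big[(W-\hat W)\Sigma_X(W-\hat W)^\top\big]$ and its rate is $\frac1n\mathbb E[\ell(f(W,\Sigma_X))]$ bits per weight, where $\ell$ is the length of a string. Let $R^*(D,\Sigma_X)\in[0,\infty]$ be the infimum of the rates of all schemes whose distortion is at most $D$. For $D>0$ let $$R_{\mathrm{WF}}(D,\Sigma_X)=\frac1n\sum_{i=1}^n\frac12\log_2\Big(\max\Big\{1,\frac{\sigma_W^2\lambda_i}{\tau}\Big\}\Big),\qquad\text{where } \tau>0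 \text{ satisfies } D=\frac1n\sum_{i=1}^n\min\{\sigma_W^2\lambda_i,\tau\},$$ and $R_{\mathrm{WF}}(D,\Sigma_X)=0$ if $D>\frac1n\sum_{i=1}^n\sigma_W^2\lambda_i$, where no such $\tau$ exists. (The value does not depend on the choice of $\tau$.) Then for every $n\ge1$, every $\sigma_W>0$, every positive semidefinite $\Sigma_X$ and every $D>0$, $$R^*(D,\Sigma_X)\ \ge\ R_{\mathrm{WF}}(D,\Sigma_X),$$ and if moreover $D<\min_i\sigma_W^2\lambda_i$, then $$R_{\mathrm{WF}}(D,\Sigma_X)=\frac12\log_2\left(\frac{\sigma_W^2\,|\Sigma_X|^{1/n}}{D}\right),$$ where $|\Sigma_X|$ is the determinant of $\Sigma_X$. -/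

import Mathlib

open MeasureTheory ProbabilityTheory
open scoped ENNReal Matrix

namespace WeightOnly

/-- The law of a weight row `W = (W₁, …, Wₙ)` with iid `N(0, σ²)` entries. -/
noncomputable def weightLaw (n : ℕ) (σ : ℝ) : Measure (Fin n → ℝ) :=
  Measure.pi fun _ => gaussianReal 0 ⟨σ ^ 2, sq_nonneg σ⟩

/-- An encoder, which sees the weight row and the matrix `Σ_X`, and a decoder, which sees only the
binary string that the encoder produced. -/
structure Scheme (n : ℕ) where
  encode : (Fin n → ℝ) → Matrix (Fin n) (Fin n) ℝ → List Bool
  decode : List Bool → (Fin n → ℝ)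

/-- The encoder, used with the matrix `S`, is an admissible variable-length binary source code:
it is measurable, and the set of codewords is uniquely decodable (a concatenation of the codewords
of several weight rows determines the codewords), where the trivial code that sends nothing is also
admitted. -/
def Scheme.Admissible {n : ℕ} (c : Scheme n) (S : Matrix (Fin n) (Fin n) ℝ) : Prop :=
  (∀ s : List Bool, MeasurableSet {w | c.encode w S = s}) ∧
    (InformationTheory.UniquelyDecodable (Set.range fun w => c.encode w S) ∨
      ∀ w, c.encode w S = [])

/-- The rate in bits per weight: `n⁻¹ 𝔼[length of f(W, S)]`. -/
noncomputable def Scheme.rate {n : ℕ} (c : Scheme n) (σ : ℝ) (S : Matrix (Fin n) (Fin n) ℝ) :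
    ℝ≥0∞ :=
  (∫⁻ w, ((c.encode w S).length : ℝ≥0∞) ∂(weightLaw n σ)) / n

/-- The distortion `n⁻¹ 𝔼[(W - Ŵ) S (W - Ŵ)ᵀ]` with `Ŵ = g(f(W, S))`. For positive semidefinite `S`
the integrand is nonnegative. -/
noncomputable def Scheme.distortion {n : ℕ} (c : Scheme n) (σ : ℝ)
    (S : Matrix (Fin n) (Fin n) ℝ) : ℝ≥0∞ :=
  (∫⁻ w, ENNReal.ofReal
    ((w - c.decode (c.encode w S)) ⬝ᵥ (S *ᵥ (w - c.decode (c.encode w S)))) ∂(weightLaw n σ)) / n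

/-- The optimal rate `R*(D, S)`: the infimum of the rates of all schemes whose distortion is
at most `D`. -/
noncomputable def optimalRate {n : ℕ} (σ D : ℝ) (S : Matrix (Fin n) (Fin n) ℝ) : ℝ≥0∞ :=
  sInf {R | ∃ c : Scheme n, c.Admissible S ∧ c.distortion σ S ≤ ENNReal.ofReal D ∧
    c.rate σ S = R}

/-- `n⁻¹ ∑ᵢ min {aᵢ, τ}`: the distortion at water level `τ`, for component variances `a`. -/
noncomputable def levelDistortion {n : ℕ} (a : Fin n → ℝ) (τ : ℝ) : ℝ :=
  1 / (n : ℝ) * ∑ i, min (a i) τ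

/-- `n⁻¹ ∑ᵢ ½ log₂ max {1, aᵢ / τ}`: the rate at water level `τ`, for component variances `a`. -/
noncomputable def levelRate {n : ℕ} (a : Fin n → ℝ) (τ : ℝ) : ℝ :=
  1 / (n : ℝ) * ∑ i, 1 / 2 * Real.logb 2 (max 1 (a i / τ))

open Classical in
/-- The reverse-waterfilling rate for component variances `a` at distortion `D > 0`: the rate at a
water level `τ > 0` whose distortion is `D`. It does not depend on the choice of `τ`
(`waterfilling_eq`). A level exists for `0 < D ≤ n⁻¹ ∑ᵢ aᵢ` (`exists_level`); there is none for
`D > n⁻¹ ∑ᵢ aᵢ`, where the rate is `0`. -/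
noncomputable def waterfilling {n : ℕ} (a : Fin n → ℝ) (D : ℝ) : ℝ :=
  if h : ∃ τ : ℝ, 0 < τ ∧ D = levelDistortion a τ then levelRate a h.choose else 0

theorem levelRate_eq_of_lt {n : ℕ} {a : Fin n → ℝ} {τ τ' : ℝ} (hτ : 0 < τ) (hlt : τ < τ')
    (h : levelDistortion a τ = levelDistortion a τ') : levelRate a τ = levelRate a τ' := by
  rcases Nat.eq_zero_or_pos n with rfl | hn
  · simp [levelRate]
  have hn' : (1 / (n : ℝ)) ≠ 0 := by positivity
  have hsum := mul_left_cancel₀ hn' h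
  have hle : ∀ i ∈ Finset.univ, min (a i) τ ≤ min (a i) τ' :=
    fun i _ => min_le_min_left _ hlt.le
  have heq := (Finset.sum_eq_sum_iff_of_le hle).1 hsum
  have ha : ∀ i, a i ≤ τ := by
    intro i
    by_contra hi
    push Not at hi
    have h1 := heq i (Finset.mem_univ i)
    rw [min_eq_right hi.le] at h1
    have h2 : τ < min (a i) τ' := lt_min hi hlt
    exact absurd h1 h2.ne
  unfold levelRate
  congr 1
  refine Finset.sum_congr rfl fun i _ => ?_
  have h1 : a i / τ ≤ 1 := (div_le_one hτ).2 (ha i)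
  have h2 : a i / τ' ≤ 1 := (div_le_one (hτ.trans hlt)).2 ((ha i).trans hlt.le)
  rw [max_eq_left h1, max_eq_left h2]

theorem waterfilling_eq {n : ℕ} (a : Fin n → ℝ) {D τ : ℝ} (hτ : 0 < τ)
    (h : D = levelDistortion a τ) : waterfilling a D = levelRate a τ := by
  have hex : ∃ τ : ℝ, 0 < τ ∧ D = levelDistortion a τ := ⟨τ, hτ, h⟩
  unfold waterfilling
  rw [dif_pos hex]
  have h1 := hex.choose_spec
  rcases lt_trichotomy hex.choose τ with hl | he | hl
  · exact levelRate_eq_of_lt h1.1 hl (h1.2.symm.trans h)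
  · rw [he]
  · exact (levelRate_eq_of_lt hτ hl (h.symm.trans h1.2)).symm

theorem exists_level {n : ℕ} (a : Fin n → ℝ) (ha : ∀ i, 0 ≤ a i) {D : ℝ} (hD : 0 < D)
    (hD' : D ≤ 1 / (n : ℝ) * ∑ i, a i) : ∃ τ : ℝ, 0 < τ ∧ D = levelDistortion a τ := by
  have hc : Continuous (levelDistortion a) := by unfold levelDistortion; fun_prop
  have h0 : levelDistortion a 0 = 0 := by
    simp [levelDistortion, min_eq_right (ha _)]
  have hM : levelDistortion a (∑ i, a i) = 1 / (n : ℝ) * ∑ i, a i := by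
    unfold levelDistortion
    congr 1
    refine Finset.sum_congr rfl fun i _ => min_eq_left ?_
    exact Finset.single_le_sum (fun j _ => ha j) (Finset.mem_univ i)
  obtain ⟨τ, hτ, h⟩ := intermediate_value_Icc (Finset.sum_nonneg fun i _ => ha i) hc.continuousOn
    (show D ∈ Set.Icc _ _ from ⟨by rw [h0]; exact hD.le, by rw [hM]; exact hD'⟩)
  refine ⟨τ, lt_of_le_of_ne hτ.1 ?_, h.symm⟩
  rintro rfl
  rw [h0] at h
  exact hD.ne h

/-- `R_WF(D, S)`: reverse waterfilling over the numbers `σ² λᵢ`, where the `λᵢ` are the eigenvalues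
of `S` with multiplicity. -/
noncomputable def waterfillingRate {n : ℕ} (σ D : ℝ) {S : Matrix (Fin n) (Fin n) ℝ}
    (hS : S.IsHermitian) : ℝ :=
  waterfilling (fun i => σ ^ 2 * hS.eigenvalues i) D

end WeightOnly

/-! The converse is proved through a dual certificate, without mutual information. Write `Q` for the
quadratic distortion, `ℓ` for the code length and `v = σ²`. At water level `τ` there is a function
`T(w)`, a sum of one-variable tilts in an eigenbasis of `S`, such that `𝔼 exp(T(W) - Q(W - y) /
(2τ)) ≤ 1` for every fixed reconstruction `y` (`lintegral_exp_totalTilt_sub_le_one`).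

The decoder output depends only on the codeword. Summing this bound over codewords with weights
`2^(-length)` and applying Kraft–McMillan gives `𝔼 exp(T - Q/(2τ) - ℓ log 2) ≤ 1`
(`Scheme.Admissible.lintegral_le_one`). By Jensen the exponent has nonpositive mean, so `𝔼 T ≤ 𝔼 ℓ ·
log 2 + 𝔼 Q / (2τ)`.

On the other side, `𝔼 T = ∑ᵢ (min (vλᵢ) τ / (2τ) + ½ log max 1 (vλᵢ/τ))` (`integral_totalTilt`). The
first part is `nD / (2τ)` by the choice of `τ` and cancels the distortion term; the second is `n log
2` times the waterfilling rate. -/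

open scoped NNReal

namespace WeightOnly

/-! ### The tilt in one coordinate -/

/-- The log-density, in one coordinate, of the tilting weight that is optimal at water level `τ`
for a component with variance `v` and eigenvalue `l`. -/
noncomputable def tilt (v : ℝ≥0) (τ l z : ℝ) : ℝ :=
  min (1 / (v : ℝ)) (l / τ) * z ^ 2 / 2 + 1 / 2 * Real.log (max 1 ((v : ℝ) * l / τ))

/-- The two cases are the two sides of the water level. If `v l ≤ τ`, the tilt cancels the `z²` term
of the distortion, and the Gaussian moment generating function evaluates what remains. If `v l > τ`,
the tilt cancels the exponent of the prior density instead, and the integrand becomes the density of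
`N(y, τ/l)`, of mass exactly `1`. -/
theorem lintegral_exp_tilt_sub_le_one {v : ℝ≥0} {τ l : ℝ} (hv : v ≠ 0) (hτ : 0 < τ) (hl : 0 ≤ l)
    (y : ℝ) :
    ∫⁻ z, ENNReal.ofReal (Real.exp (tilt v τ l z - l * (z - y) ^ 2 / (2 * τ)))
      ∂(gaussianReal 0 v) ≤ 1 := by
  have hσ2 : 0 < (v : ℝ) := by positivity
  rcases le_or_gt ((v : ℝ) * l) τ with h | h
  · have h1 : l / τ ≤ 1 / (v : ℝ) := by
      rw [div_le_div_iff₀ hτ hσ2]; linarith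
    have h2 : max 1 ((v : ℝ) * l / τ) = 1 := max_eq_left ((div_le_one hτ).2 h)
    have h3 : ∀ z, Real.exp (tilt v τ l z - l * (z - y) ^ 2 / (2 * τ)) =
        Real.exp (-(l * y ^ 2 / (2 * τ))) * Real.exp (l * y / τ * z) := by
      intro z
      rw [tilt, min_eq_right h1, h2, Real.log_one, ← Real.exp_add]
      congr 1
      field_simp
      ring
    simp_rw [h3]
    rw [← ofReal_integral_eq_lintegral_ofReal
      ((integrable_exp_mul_gaussianReal _).const_mul _)
      (Filter.Eventually.of_forall fun z => by positivity)]
    rw [integral_const_mul]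
    have h4 := congrFun (mgf_fun_id_gaussianReal (μ := 0) (v := v)) (l * y / τ)
    unfold mgf at h4
    rw [h4, ← Real.exp_add, ← ENNReal.ofReal_one]
    refine ENNReal.ofReal_le_ofReal (Real.exp_le_one_iff.2 ?_)
    have h5 : -(l * y ^ 2 / (2 * τ)) + (0 * (l * y / τ) + (v : ℝ) * (l * y / τ) ^ 2 / 2) =
      - (l * y ^ 2 / (2 * τ ^ 2) * (τ - (v : ℝ) * l)) := by
      field_simp
      ring
    rw [h5, neg_nonpos]
    have := sub_nonneg.2 h
    positivity
  · have hl : 0 < l := by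
      by_contra hl
      nlinarith
    have h1 : 1 / (v : ℝ) ≤ l / τ := by
      rw [div_le_div_iff₀ hσ2 hτ]; linarith
    have h2 : max 1 ((v : ℝ) * l / τ) = (v : ℝ) * l / τ := max_eq_right ((one_le_div hτ).2 h.le)
    have hwc : ((τ / l).toNNReal : ℝ) = τ / l := Real.coe_toNNReal _ (by positivity)
    have hw : (τ / l).toNNReal ≠ 0 := by
      rw [← NNReal.coe_ne_zero, hwc]; positivity
    rw [gaussianReal_of_var_ne_zero 0 hv,
      lintegral_withDensity_eq_lintegral_mul₀ (by fun_prop)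
        (by unfold tilt; fun_prop)]
    refine le_of_eq ((lintegral_congr fun z => ?_).trans
      (lintegral_gaussianPDF_eq_one y hw))
    rw [Pi.mul_apply, gaussianPDF_def, gaussianPDF_def, ← ENNReal.ofReal_mul (gaussianPDFReal_nonneg _ _ _)]
    congr 1
    simp only [gaussianPDFReal, tilt, hwc, min_eq_left h1, h2]
    -- The logarithmic term of the tilt is the ratio of the normalizing constants of `N(0, v)` and
    -- `N(y, τ/l)`.
    have h6 : Real.exp (1 / 2 * Real.log ((v : ℝ) * l / τ)) = √((v : ℝ) * l / τ) := by
      rw [Real.sqrt_eq_rpow, Real.rpow_def_of_pos (by positivity), mul_comm]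
    rw [add_sub_right_comm, Real.exp_add _ (1 / 2 * _), h6]
    rw [show ∀ a b c d : ℝ, a * b * (c * d) = (a * d) * (b * c) by intros; ring, ← Real.exp_add]
    congr 1
    · rw [← Real.sqrt_inv, ← Real.sqrt_inv, ← Real.sqrt_mul (by positivity)]
      congr 1
      field_simp
    · congr 1
      field_simp
      ring

theorem integrable_tilt (v : ℝ≥0) (τ l : ℝ) :
    Integrable (tilt v τ l) (gaussianReal 0 v) := by
  have := (memLp_id_gaussianReal (μ := 0) (v := v) 2).integrable_sq
  unfold tilt
  simp only [id] at this
  exact ((this.const_mul _).div_const _).add (integrable_const _)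

/-- Since the second moment is `v`, the quadratic part averages to the waterfilling distortion of
the component divided by `2τ`; the constant part is its rate in nats. -/
theorem integral_tilt {v : ℝ≥0} {τ : ℝ} (hv : v ≠ 0) (hτ : 0 < τ) (l : ℝ) :
    ∫ z, tilt v τ l z ∂(gaussianReal 0 v) =
      min ((v : ℝ) * l) τ / (2 * τ) + 1 / 2 * Real.log (max 1 ((v : ℝ) * l / τ)) := by
  have hi := (memLp_id_gaussianReal (μ := 0) (v := v) 2).integrable_sq
  have hvar := variance_fun_id_gaussianReal (μ := 0) (v := v)
  rw [variance_of_integral_eq_zero (by fun_prop) integral_id_gaussianReal] at hvar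
  simp only [id] at hi hvar
  unfold tilt
  rw [integral_add ((hi.const_mul _).div_const _) (integrable_const _), integral_div,
    integral_const_mul, hvar]
  simp only [integral_const, probReal_univ, one_smul]
  congr 1
  rw [min_mul_of_nonneg _ _ v.coe_nonneg]
  have h1 : 1 / (v : ℝ) * (v : ℝ) = τ / τ := by field_simp
  have h2 : l / τ * (v : ℝ) = (v : ℝ) * l / τ := by ring
  rw [h1, h2, min_div_div_right hτ.le, min_comm]
  field_simp

/-! ### Rotation invariance of the weight law -/

variable {n : ℕ}

theorem weightLaw_eq (σ : ℝ) :
    weightLaw n σ = Measure.pi fun _ => gaussianReal 0 (σ ^ 2).toNNReal := by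
  rw [Real.toNNReal_of_nonneg (sq_nonneg σ)]
  rfl

instance (σ : ℝ) : IsProbabilityMeasure (weightLaw n σ) := by
  rw [weightLaw_eq]; infer_instance

/-- The characteristic function depends on `t` only through its norm, which is what makes the law
rotation invariant. -/
theorem charFun_weightLaw (σ : ℝ) (t : EuclideanSpace ℝ (Fin n)) :
    charFun ((weightLaw n σ).map (WithLp.toLp 2)) t =
      Complex.exp (-(σ ^ 2 * ‖t‖ ^ 2 / 2 : ℝ)) := by
  rw [weightLaw_eq]
  simp_rw [charFun_pi, charFun_gaussianReal, ← Complex.exp_sum,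
    EuclideanSpace.real_norm_sq_eq]
  congr 1
  rw [Real.coe_toNNReal _ (sq_nonneg σ)]
  push_cast
  simp [Finset.sum_div, Finset.mul_sum]

/-- The law of the weights is invariant under orthogonal transformations. -/
theorem measurePreserving_weightLaw (σ : ℝ)
    (f : EuclideanSpace ℝ (Fin n) ≃ₗᵢ[ℝ] EuclideanSpace ℝ (Fin n)) :
    MeasurePreserving (fun w : Fin n → ℝ => (f (WithLp.toLp 2 w)).ofLp)
      (weightLaw n σ) (weightLaw n σ) := by
  have hm : Measurable (WithLp.toLp 2 : (Fin n → ℝ) → EuclideanSpace ℝ (Fin n)) := by fun_prop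
  have hm' : Measurable (WithLp.ofLp : EuclideanSpace ℝ (Fin n) → (Fin n → ℝ)) := by fun_prop
  have hf : Measurable f := f.continuous.measurable
  have : IsProbabilityMeasure ((weightLaw n σ).map
    (WithLp.toLp 2 : (Fin n → ℝ) → EuclideanSpace ℝ (Fin n))) :=
      Measure.isProbabilityMeasure_map hm.aemeasurable
  have key : ((weightLaw n σ).map (WithLp.toLp 2)).map f =
      (weightLaw n σ).map (WithLp.toLp 2) := by
    have : IsProbabilityMeasure (((weightLaw n σ).map
      (WithLp.toLp 2 : (Fin n → ℝ) → EuclideanSpace ℝ (Fin n))).map f) :=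
        Measure.isProbabilityMeasure_map hf.aemeasurable
    apply Measure.ext_of_charFun (E := EuclideanSpace ℝ (Fin n))
    ext t
    have h1 : charFun (((weightLaw n σ).map (WithLp.toLp 2)).map f) t =
        charFun ((weightLaw n σ).map (WithLp.toLp 2)) (f.symm t) := by
      rw [charFun_apply, charFun_apply, integral_map hf.aemeasurable (by fun_prop)]
      simp_rw [← f.inner_map_map _ (f.symm t), f.apply_symm_apply]
    rw [h1, charFun_weightLaw, charFun_weightLaw, LinearIsometryEquiv.norm_map]
  refine ⟨hm'.comp (hf.comp hm), ?_⟩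
  have h2 := congrArg (Measure.map WithLp.ofLp) key
  rw [Measure.map_map hf hm, Measure.map_map hm' (hf.comp hm), Measure.map_map hm' hm] at h2
  refine h2.trans ?_
  exact Measure.map_id

/-! ### Kraft–McMillan for possibly infinite codes -/

/-- The Kraft sum of an admissible code is at most `1`. -/
theorem tsum_kraft_le_one {C : Set (List Bool)}
    (hC : InformationTheory.UniquelyDecodable C ∨ C ⊆ {[]}) :
    ∑' s : C, ENNReal.ofReal ((1 / 2) ^ s.1.length) ≤ 1 := by
  rw [ENNReal.tsum_eq_iSup_sum]
  refine iSup_le fun F => ?_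
  rw [← ENNReal.ofReal_sum_of_nonneg fun s _ => by positivity, ENNReal.ofReal_le_one]
  classical
  have hF : ∑ s ∈ F, (1 / 2 : ℝ) ^ s.1.length =
      ∑ s ∈ F.map (Function.Embedding.subtype _), (1 / 2 : ℝ) ^ s.length := by
    simp [Finset.sum_map]
  have hsub : (↑(F.map (Function.Embedding.subtype _)) : Set (List Bool)) ⊆ C := by
    intro s hs
    simp only [Finset.coe_map, Set.mem_image, Function.Embedding.subtype_apply] at hs
    obtain ⟨x, -, rfl⟩ := hs
    exact x.2
  rw [hF]
  rcases hC with hC | hC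
  -- Kraft–McMillan is applied to finite subsets, which inherit unique decodability.
  · have hu : InformationTheory.UniquelyDecodable
        (↑(F.map (Function.Embedding.subtype _)) : Set (List Bool)) :=
      fun L₁ L₂ h₁ h₂ => hC L₁ L₂ (fun w hw => hsub (h₁ w hw)) (fun w hw => hsub (h₂ w hw))
    simpa using InformationTheory.kraft_mcmillan_inequality hu
  -- The code `{[]}` is not uniquely decodable, but its only codeword contributes `2^0 = 1`.
  · have : F.map (Function.Embedding.subtype _) ⊆ {[]} := by
      intro s hs
      simpa using hC (hsub (Finset.mem_coe.2 hs))
    refine (Finset.sum_le_sum_of_subset_of_nonneg this fun _ _ _ => by positivity).trans ?_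
    simp

/-! ### The tilt in eigenbasis coordinates -/

theorem dotProduct_mulVec_eq_sum {S : Matrix (Fin n) (Fin n) ℝ} (hS : S.IsHermitian)
    (v : Fin n → ℝ) :
    v ⬝ᵥ (S *ᵥ v) =
      ∑ i, hS.eigenvalues i * (hS.eigenvectorBasis.repr (WithLp.toLp 2 v)).ofLp i ^ 2 := by
  have h1 : v ⬝ᵥ (S *ᵥ v) = inner ℝ (WithLp.toLp 2 (S *ᵥ v)) (WithLp.toLp 2 v) := by
    simp [EuclideanSpace.inner_toLp_toLp]
  rw [h1, ← hS.eigenvectorBasis.sum_inner_mul_inner]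
  refine Finset.sum_congr rfl fun i _ => ?_
  have h2 : inner ℝ (WithLp.toLp 2 (S *ᵥ v)) (hS.eigenvectorBasis i) =
      hS.eigenvalues i * inner ℝ (hS.eigenvectorBasis i) (WithLp.toLp 2 v) := by
    have h3 := hS.mulVec_eigenvectorBasis i
    have h4 : inner ℝ (WithLp.toLp 2 (S *ᵥ v)) (hS.eigenvectorBasis i) =
        (S *ᵥ (hS.eigenvectorBasis i).ofLp) ⬝ᵥ v := by
      have hT : Sᵀ = S := by simpa [Matrix.IsHermitian] using hS.eq
      rw [EuclideanSpace.inner_eq_star_dotProduct, star_trivial, Matrix.dotProduct_mulVec,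
        ← Matrix.mulVec_transpose, hT]
    rw [h4, h3, EuclideanSpace.inner_eq_star_dotProduct, smul_dotProduct, star_trivial,
      smul_eq_mul, dotProduct_comm]
  rw [h2, OrthonormalBasis.repr_apply_apply]
  ring

/-- Both the tilt and the distortion are sums over coordinates, so by independence the integral
factors into the one-coordinate bounds. -/
theorem lintegral_exp_sum_tilt_sub_le_one {v : ℝ≥0} {τ : ℝ} (hv : v ≠ 0) (hτ : 0 < τ)
    {l : Fin n → ℝ} (hl : ∀ i, 0 ≤ l i) (y : Fin n → ℝ) :
    ∫⁻ z : Fin n → ℝ, ENNReal.ofReal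
      (Real.exp (∑ i, (tilt v τ (l i) (z i) - l i * (z i - y i) ^ 2 / (2 * τ))))
      ∂(Measure.pi fun _ => gaussianReal 0 v) ≤ 1 := by
  have hm : ∀ i, Measurable fun z : ℝ => ENNReal.ofReal
      (Real.exp (tilt v τ (l i) z - l i * (z - y i) ^ 2 / (2 * τ))) := by
    intro i
    unfold tilt
    fun_prop
  have hind := iIndepFun_pi (μ := fun _ : Fin n => gaussianReal 0 v)
    (X := fun i z => ENNReal.ofReal
      (Real.exp (tilt v τ (l i) z - l i * (z - y i) ^ 2 / (2 * τ))))
    fun i => (hm i).aemeasurable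
  have hprod := lintegral_prod_eq_prod_lintegral_of_indepFun Finset.univ _ hind
    fun i => (hm i).comp (measurable_pi_apply i)
  simp_rw [Real.exp_sum, ENNReal.ofReal_prod_of_nonneg fun _ _ => (Real.exp_pos _).le]
  rw [hprod]
  refine Finset.prod_le_one' fun i _ => ?_
  have hmp := measurePreserving_eval (fun _ : Fin n => gaussianReal 0 v) i
  exact (hmp.lintegral_comp (hm i)).trans_le (lintegral_exp_tilt_sub_le_one hv hτ (hl i) (y i))

/-- The coordinates of a weight row in an orthonormal eigenbasis. -/
noncomputable def eigenCoord {S : Matrix (Fin n) (Fin n) ℝ} (hS : S.IsHermitian)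
    (w : Fin n → ℝ) : Fin n → ℝ :=
  (hS.eigenvectorBasis.repr (WithLp.toLp 2 w)).ofLp

theorem eigenCoord_sub {S : Matrix (Fin n) (Fin n) ℝ} (hS : S.IsHermitian)
    (v w : Fin n → ℝ) : eigenCoord hS (v - w) = eigenCoord hS v - eigenCoord hS w := by
  simp [eigenCoord]

theorem measurePreserving_eigenCoord {S : Matrix (Fin n) (Fin n) ℝ} (hS : S.IsHermitian) (σ : ℝ) :
    MeasurePreserving (eigenCoord hS) (weightLaw n σ) (weightLaw n σ) :=
  measurePreserving_weightLaw σ hS.eigenvectorBasis.repr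

/-- The sum of the coordinate tilts. -/
noncomputable def totalTilt (v : ℝ≥0) (τ : ℝ) (l z : Fin n → ℝ) : ℝ :=
  ∑ i, tilt v τ (l i) (z i)

theorem measurable_totalTilt (v : ℝ≥0) (τ : ℝ) (l : Fin n → ℝ) :
    Measurable (totalTilt v τ l) := by
  unfold totalTilt tilt
  fun_prop

theorem lintegral_exp_totalTilt_sub_le_one {σ τ : ℝ} (hσ : 0 < σ) (hτ : 0 < τ)
    {S : Matrix (Fin n) (Fin n) ℝ} (hS : S.PosSemidef) (y : Fin n → ℝ) :
    ∫⁻ w, ENNReal.ofReal (Real.exp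
      (totalTilt (σ ^ 2).toNNReal τ hS.isHermitian.eigenvalues (eigenCoord hS.isHermitian w) -
        (w - y) ⬝ᵥ (S *ᵥ (w - y)) / (2 * τ))) ∂(weightLaw n σ) ≤ 1 := by
  have hv : (σ ^ 2).toNNReal ≠ 0 := (Real.toNNReal_pos.2 (by positivity)).ne'
  have h := lintegral_exp_sum_tilt_sub_le_one hv hτ (fun i => hS.eigenvalues_nonneg i)
    (eigenCoord hS.isHermitian y)
  rw [← weightLaw_eq, ← (measurePreserving_eigenCoord hS.isHermitian σ).lintegral_comp
    (by unfold tilt; fun_prop)] at h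
  refine (lintegral_congr fun w => ?_).trans_le h
  rw [dotProduct_mulVec_eq_sum hS.isHermitian]
  change ENNReal.ofReal (Real.exp (_ - (∑ i, hS.isHermitian.eigenvalues i *
    eigenCoord hS.isHermitian (w - y) i ^ 2) / (2 * τ))) = _
  rw [totalTilt, Finset.sum_div, ← Finset.sum_sub_distrib, eigenCoord_sub]
  rfl

theorem integrable_totalTilt (v : ℝ≥0) (τ : ℝ) (l : Fin n → ℝ) :
    Integrable (totalTilt v τ l) (Measure.pi fun _ => gaussianReal 0 v) :=
  integrable_finsetSum _ fun i _ => integrable_comp_eval (integrable_tilt v τ (l i))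

theorem integral_totalTilt {v : ℝ≥0} {τ : ℝ} (hv : v ≠ 0) (hτ : 0 < τ) (l : Fin n → ℝ) :
    ∫ z, totalTilt v τ l z ∂(Measure.pi fun _ => gaussianReal 0 v) =
      ∑ i, (min (v * l i) τ / (2 * τ) + 1 / 2 * Real.log (max 1 (v * l i / τ))) := by
  unfold totalTilt
  rw [integral_finsetSum _ fun i _ => integrable_comp_eval (integrable_tilt v τ (l i))]
  refine Finset.sum_congr rfl fun i _ => ?_
  rw [integral_comp_eval (integrable_tilt v τ (l i)).aestronglyMeasurable, integral_tilt]
  all_goals assumption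

theorem Scheme.Admissible.measurable_comp_encode {c : Scheme n} {S : Matrix (Fin n) (Fin n) ℝ}
    (hc : c.Admissible S) {β : Type*} [MeasurableSpace β] (f : List Bool → β) :
    Measurable fun w => f (c.encode w S) := by
  let _ : MeasurableSpace (List Bool) := ⊤
  have h : Measurable fun w => c.encode w S := measurable_to_countable' fun s => hc.1 s
  exact (measurable_from_top (f := f)).comp h

/-! ### The converse bound -/

/-- The exponential of tilt minus scaled distortion minus code length has integral at most `1`. -/
theorem Scheme.Admissible.lintegral_le_one {c : Scheme n} {S : Matrix (Fin n) (Fin n) ℝ}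
    (hc : c.Admissible S) {σ τ : ℝ} (hσ : 0 < σ) (hτ : 0 < τ) (hS : S.PosSemidef) :
    ∫⁻ w, ENNReal.ofReal ((1 / 2) ^ (c.encode w S).length * Real.exp
      (totalTilt (σ ^ 2).toNNReal τ hS.isHermitian.eigenvalues (eigenCoord hS.isHermitian w) -
        (w - c.decode (c.encode w S)) ⬝ᵥ (S *ᵥ (w - c.decode (c.encode w S))) / (2 * τ)))
      ∂(weightLaw n σ) ≤ 1 := by
  let C : Set (List Bool) := Set.range fun w => c.encode w S
  let F : List Bool → (Fin n → ℝ) → ℝ≥0∞ := fun s w => ENNReal.ofReal (Real.exp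
      (totalTilt (σ ^ 2).toNNReal τ hS.isHermitian.eigenvalues (eigenCoord hS.isHermitian w) -
        (w - c.decode s) ⬝ᵥ (S *ᵥ (w - c.decode s)) / (2 * τ)))
  have hF : ∀ s, Measurable (F s) := by
    intro s
    have := (measurable_totalTilt (σ ^ 2).toNNReal τ hS.isHermitian.eigenvalues).comp
      (measurePreserving_eigenCoord hS.isHermitian σ).measurable
    have hd : Measurable fun w : Fin n → ℝ =>
        (w - c.decode s) ⬝ᵥ (S *ᵥ (w - c.decode s)) := by
      unfold Matrix.mulVec dotProduct
      simp only [Pi.sub_apply]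
      fun_prop
    exact (Real.measurable_exp.comp (this.sub (hd.div_const _))).ennreal_ofReal
  have hC : InformationTheory.UniquelyDecodable C ∨ C ⊆ {[]} := by
    refine hc.2.imp id fun h => ?_
    rintro _ ⟨w, rfl⟩
    exact h w
  -- Adding the nonnegative terms of all codewords that were not sent decouples the reconstruction
  -- from `w`: in each term `c.decode s` is constant.
  calc _ ≤ ∫⁻ w, ∑' s : C, ENNReal.ofReal ((1 / 2) ^ s.1.length) * F s w ∂(weightLaw n σ) := by
        refine lintegral_mono fun w => ?_
        rw [ENNReal.ofReal_mul (by positivity)]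
        exact ENNReal.le_tsum (f := fun s : C => ENNReal.ofReal ((1 / 2) ^ s.1.length) * F s w)
          ⟨c.encode w S, w, rfl⟩
    _ = ∑' s : C, ENNReal.ofReal ((1 / 2) ^ s.1.length) * ∫⁻ w, F s w ∂(weightLaw n σ) := by
        rw [lintegral_tsum fun s : C => ((hF s).const_mul _).aemeasurable]
        exact tsum_congr fun s => lintegral_const_mul _ (hF s)
    _ ≤ ∑' s : C, ENNReal.ofReal ((1 / 2) ^ s.1.length) := by
        refine ENNReal.tsum_le_tsum fun s => mul_le_of_le_one_right' ?_
        exact lintegral_exp_totalTilt_sub_le_one hσ hτ hS (c.decode s)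
    _ ≤ 1 := tsum_kraft_le_one hC

/-- This is Jensen's inequality applied to `lintegral_le_one`; the finite bounds `L` and `d` make
all terms integrable. -/
theorem Scheme.Admissible.integral_totalTilt_le {c : Scheme n} {S : Matrix (Fin n) (Fin n) ℝ}
    (hc : c.Admissible S) {σ τ : ℝ} (hσ : 0 < σ) (hτ : 0 < τ) (hS : S.PosSemidef) {L d : ℝ}
    (hL : ∫⁻ w, ((c.encode w S).length : ℝ≥0∞) ∂(weightLaw n σ) ≤ ENNReal.ofReal L) (hL0 : 0 ≤ L)
    (hd : ∫⁻ w, ENNReal.ofReal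
      ((w - c.decode (c.encode w S)) ⬝ᵥ (S *ᵥ (w - c.decode (c.encode w S)))) ∂(weightLaw n σ) ≤
        ENNReal.ofReal d) (hd0 : 0 ≤ d) :
    ∫ w, totalTilt (σ ^ 2).toNNReal τ hS.isHermitian.eigenvalues w ∂(weightLaw n σ) ≤
      L * Real.log 2 + d / (2 * τ) := by
  set μ := weightLaw n σ
  set Q : (Fin n → ℝ) → ℝ := fun w =>
    (w - c.decode (c.encode w S)) ⬝ᵥ (S *ᵥ (w - c.decode (c.encode w S))) with hQdef
  set ℓ : (Fin n → ℝ) → ℝ := fun w => (c.encode w S).length with hℓdef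
  set T : (Fin n → ℝ) → ℝ := fun w => totalTilt (σ ^ 2).toNNReal τ hS.isHermitian.eigenvalues
    (eigenCoord hS.isHermitian w) with hTdef
  have hmp := measurePreserving_eigenCoord hS.isHermitian σ
  have hTi' := integrable_totalTilt (σ ^ 2).toNNReal τ hS.isHermitian.eigenvalues
  rw [← weightLaw_eq] at hTi'
  have hTi : Integrable T μ := hmp.integrable_comp_of_integrable hTi'
  have hTe : ∫ w, totalTilt (σ ^ 2).toNNReal τ hS.isHermitian.eigenvalues w ∂μ = ∫ w, T w ∂μ := by
    have h := integral_map (μ := weightLaw n σ) hmp.measurable.aemeasurable (measurable_totalTilt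
      (σ ^ 2).toNNReal τ hS.isHermitian.eigenvalues).aestronglyMeasurable
    rwa [hmp.map_eq] at h
  have hℓm : Measurable ℓ := hc.measurable_comp_encode fun s => (s.length : ℝ)
  have hQm : Measurable Q := by
    have : Measurable fun w => c.decode (c.encode w S) := hc.measurable_comp_encode c.decode
    simp only [hQdef]
    unfold Matrix.mulVec dotProduct
    simp only [Pi.sub_apply]
    fun_prop
  have hQ0 : ∀ w, 0 ≤ Q w := fun w => by
    simpa only [star_trivial] using hS.dotProduct_mulVec_nonneg (w - c.decode (c.encode w S))
  have hℓ0 : ∀ w, 0 ≤ ℓ w := fun w => Nat.cast_nonneg _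
  have hL' : ∫⁻ w, ENNReal.ofReal (ℓ w) ∂μ ≤ ENNReal.ofReal L := by
    simpa [hℓdef, ENNReal.ofReal_natCast] using hL
  have hbound : ∀ {g : (Fin n → ℝ) → ℝ} {r : ℝ}, Measurable g → (∀ w, 0 ≤ g w) → 0 ≤ r →
      ∫⁻ w, ENNReal.ofReal (g w) ∂μ ≤ ENNReal.ofReal r → Integrable g μ ∧ ∫ w, g w ∂μ ≤ r := by
    intro g r hg hg0 hr h
    refine ⟨⟨hg.aestronglyMeasurable, ?_⟩, ?_⟩
    · rw [hasFiniteIntegral_iff_ofReal (Filter.Eventually.of_forall hg0)]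
      exact h.trans_lt ENNReal.ofReal_lt_top
    · rw [integral_eq_lintegral_of_nonneg_ae (Filter.Eventually.of_forall hg0)
        hg.aestronglyMeasurable]
      exact ENNReal.toReal_le_of_le_ofReal hr h
  obtain ⟨hℓi, hℓb⟩ := hbound hℓm hℓ0 hL0 hL'
  obtain ⟨hQi, hQb⟩ := hbound hQm hQ0 hd0 hd
  have hTm : Measurable T := (measurable_totalTilt _ _ _).comp hmp.measurable
  obtain ⟨hGi, hGb⟩ := hbound (g := fun w => Real.exp (T w - Q w / (2 * τ) - ℓ w * Real.log 2))
    (r := 1) (by fun_prop) (fun w => (Real.exp_pos _).le) zero_le_one (by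
      rw [ENNReal.ofReal_one]
      refine (lintegral_congr fun w => ?_).trans_le (hc.lintegral_le_one hσ hτ hS)
      congr 1
      rw [Real.exp_sub _ (ℓ w * _), hℓdef, mul_comm _ (Real.log 2), ← Real.rpow_def_of_pos two_pos,
        Real.rpow_natCast, one_div, inv_pow, div_eq_inv_mul])
  -- Jensen in pointwise form, from `x + 1 ≤ exp x`; the bracket has nonpositive integral by `hGb`.
  have hpt : ∀ w, T w ≤ ℓ w * Real.log 2 + Q w / (2 * τ) +
      (Real.exp (T w - Q w / (2 * τ) - ℓ w * Real.log 2) - 1) := fun w => by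
    linarith [Real.add_one_le_exp (T w - Q w / (2 * τ) - ℓ w * Real.log 2)]
  have hi1 := (hℓi.mul_const (Real.log 2)).add (hQi.div_const (2 * τ))
  have hi2 := hGi.sub (integrable_const (1 : ℝ))
  have hint := integral_mono hTi (hi1.add hi2) hpt
  have he : ∫ w, (((fun w => ℓ w * Real.log 2) + (fun w => Q w / (2 * τ)) : (Fin n → ℝ) → ℝ) +
      ((fun w => Real.exp (T w - Q w / (2 * τ) - ℓ w * Real.log 2)) - (fun _ => (1 : ℝ)) : (Fin n → ℝ) → ℝ)) w ∂μ =
      (∫ w, ℓ w ∂μ) * Real.log 2 + (∫ w, Q w ∂μ) / (2 * τ) +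
        ((∫ w, Real.exp (T w - Q w / (2 * τ) - ℓ w * Real.log 2) ∂μ) - 1) := by
    rw [integral_add' hi1 hi2, integral_add' (hℓi.mul_const _) (hQi.div_const _),
      integral_sub' hGi (integrable_const _), integral_mul_const, integral_div]
    simp [μ]
  rw [hTe]
  refine hint.trans ?_
  refine he.trans_le ?_
  have h1 : (∫ w, ℓ w ∂μ) * Real.log 2 ≤ L * Real.log 2 :=
    mul_le_mul_of_nonneg_right hℓb (Real.log_nonneg one_le_two)
  have h2 : (∫ w, Q w ∂μ) / (2 * τ) ≤ d / (2 * τ) :=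
    div_le_div_of_nonneg_right hQb (by positivity)
  linarith

theorem waterfillingRate_le_optimalRate (hn : 0 < n) {σ D : ℝ} (hσ : 0 < σ) (hD : 0 < D)
    {S : Matrix (Fin n) (Fin n) ℝ} (hS : S.PosSemidef) :
    ENNReal.ofReal (waterfillingRate σ D hS.isHermitian) ≤ optimalRate σ D S := by
  by_cases hex : ∃ τ : ℝ, 0 < τ ∧
      D = levelDistortion (fun i => σ ^ 2 * hS.isHermitian.eigenvalues i) τ
  swap
  -- Without a water level the rate is `0` by definition, and the bound is trivial.
  · rw [waterfillingRate, waterfilling, dif_neg hex, ENNReal.ofReal_zero]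
    exact zero_le
  obtain ⟨τ, hτ, hDτ⟩ := hex
  rw [waterfillingRate, waterfilling_eq _ hτ hDτ]
  refine le_sInf ?_
  rintro _ ⟨c, hc, hdist, rfl⟩
  have hn0 : (n : ℝ≥0∞) ≠ 0 := by exact_mod_cast hn.ne'
  have hnr : (0 : ℝ) < n := by exact_mod_cast hn
  by_cases htop : ∫⁻ w, ((c.encode w S).length : ℝ≥0∞) ∂(weightLaw n σ) = ∞
  · rw [Scheme.rate, htop, ENNReal.top_div_of_ne_top (ENNReal.natCast_ne_top n)]
    exact le_top
  rw [Scheme.distortion, ENNReal.div_le_iff hn0 (ENNReal.natCast_ne_top n),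
    ← ENNReal.ofReal_natCast n, ← ENNReal.ofReal_mul hD.le] at hdist
  rw [Scheme.rate]
  have hv : (σ ^ 2).toNNReal ≠ 0 := (Real.toNNReal_pos.2 (by positivity)).ne'
  have h := hc.integral_totalTilt_le hσ hτ hS (ENNReal.ofReal_toReal htop).ge
    ENNReal.toReal_nonneg hdist (by positivity)
  rw [weightLaw_eq, integral_totalTilt hv hτ, ← weightLaw_eq] at h
  simp only [Real.coe_toNNReal _ (sq_nonneg σ)] at h
  rw [Finset.sum_add_distrib, ← Finset.sum_div] at h
  have hDn : ∑ i, min (σ ^ 2 * hS.isHermitian.eigenvalues i) τ = D * n := by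
    rw [hDτ, levelDistortion]
    field_simp
  -- The tilt's quadratic part equals the distortion budget `D n / (2τ)` exactly, so the two cancel
  -- and only the rate is left.
  rw [hDn, add_comm, add_le_add_iff_right] at h
  rw [ENNReal.le_div_iff_mul_le (Or.inl hn0) (Or.inl (ENNReal.natCast_ne_top n)),
    ← ENNReal.ofReal_toReal htop, ← ENNReal.ofReal_natCast n, ← ENNReal.ofReal_mul' hnr.le]
  refine ENNReal.ofReal_le_ofReal ?_
  have hlog : 0 < Real.log 2 := Real.log_pos one_lt_two
  refine le_of_mul_le_mul_right (le_trans (le_of_eq ?_) h) hlog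
  simp only [levelRate, Real.logb, Finset.mul_sum, Finset.sum_mul]
  refine Finset.sum_congr rfl fun i _ => ?_
  field_simp

/-! ### The closed form at small distortion -/

theorem waterfillingRate_eq_of_lt (hn : 0 < n) {σ D : ℝ} (hD : 0 < D)
    {S : Matrix (Fin n) (Fin n) ℝ} (hS : S.IsHermitian)
    (h : ∀ i, D < σ ^ 2 * hS.eigenvalues i) :
    waterfillingRate σ D hS = 1 / 2 * Real.logb 2 (σ ^ 2 * S.det ^ (1 / (n : ℝ)) / D) := by
  have hnr : (0 : ℝ) < n := by exact_mod_cast hn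
  -- When `D` lies below every component variance, all components are cut at the level, so `D` is
  -- its own water level.
  have hlev : D = levelDistortion (fun i => σ ^ 2 * hS.eigenvalues i) D := by
    simp only [levelDistortion, min_eq_right (h _).le, Finset.sum_const, Finset.card_univ,
      Fintype.card_fin, nsmul_eq_mul]
    field_simp
  have hσ : 0 < σ ^ 2 := by
    refine lt_of_le_of_ne (sq_nonneg σ) fun h0 => ?_
    have := h ⟨0, hn⟩
    rw [← h0, zero_mul] at this
    exact this.not_gt hD
  have hpos : ∀ i, 0 < hS.eigenvalues i := fun i =>
    pos_of_mul_pos_right (hD.trans (h i)) hσ.le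
  have hdet : S.det = ∏ i, hS.eigenvalues i := by simpa using hS.det_eq_prod_eigenvalues
  have hdet0 : 0 < S.det := hdet ▸ Finset.prod_pos fun i _ => hpos i
  have hmax : ∀ i, Real.log (max 1 (σ ^ 2 * hS.eigenvalues i / D)) =
      Real.log (σ ^ 2 / D) + Real.log (hS.eigenvalues i) := fun i => by
    rw [max_eq_right ((one_le_div hD).2 (h i).le), mul_div_right_comm,
      Real.log_mul (by positivity) (hpos i).ne']
  rw [waterfillingRate, waterfilling_eq _ hD hlev, levelRate]
  have hr : Real.log (σ ^ 2 * S.det ^ (1 / (n : ℝ)) / D) =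
      Real.log (σ ^ 2 / D) + 1 / n * ∑ i, Real.log (hS.eigenvalues i) := by
    rw [mul_div_right_comm, Real.log_mul (by positivity) (by positivity), Real.log_rpow hdet0,
      hdet, Real.log_prod fun i _ => (hpos i).ne']
  simp only [Real.logb, hmax, hr]
  rw [← Finset.mul_sum, ← Finset.sum_div, Finset.sum_add_distrib, Finset.sum_const,
    Finset.card_univ, Fintype.card_fin, nsmul_eq_mul]
  field_simp

end WeightOnly

theorem mainTheorem2 (n : ℕ) (hn : 0 < n) (σ : ℝ) (hσ : 0 < σ)
    (S : Matrix (Fin n) (Fin n) ℝ) (hS : S.PosSemidef) (D : ℝ) (hD : 0 < D) :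
    ENNReal.ofReal (WeightOnly.waterfillingRate σ D hS.isHermitian) ≤
        WeightOnly.optimalRate σ D S ∧
      ((∀ i, D < σ ^ 2 * hS.isHermitian.eigenvalues i) →
        WeightOnly.waterfillingRate σ D hS.isHermitian =
          1 / 2 * Real.logb 2 (σ ^ 2 * S.det ^ (1 / (n : ℝ)) / D)) :=
  ⟨WeightOnly.waterfillingRate_le_optimalRate hn hσ hD hS,
    WeightOnly.waterfillingRate_eq_of_lt hn hD hS.isHermitian⟩
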